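/- Logarithms are to base $2$. There is an absolute constant $c>0$ such that the following holds. Let $G=(V,E)$ be a chordal graph with $n\ge 2$ vertices and chromatic number $\chi$, let $w_v$ $(v\in V)$ be positive integer weights, and let $m$ be an integer with $$m\ \ge\ \log\chi+\log\log n+5 .$$ A graph separating system of size $k$ is a family $\mathcal I=(I_1,\dots,I_k)$ of subsets of $V$ such that every edge of $G$ has exactly one endpoint in $I_j$ for at least one $j$; its cost is $\mathrm{cost}(\mathcal I)=\sum_{j}\sum_{v\in I_j}w_v$. Let $\mathrm{OPT}$ be the minimum cost of a graph separating system of size at most $m$. Consider the greedy coloring algorithm with quantization. It takes a maximum weight independent set $S_0$ of $G$ with respect to $w$, puts $w_{\max}=\max_{v\in V\setminus S_0}w_v$ and $w'_v=\lfloor w_v n^3/w_{\max}\rfloor$ for $v\in V\setminus S_0$, and then, for $t=1,2,\dots$ as long as $V_t=V\setminus(S_0\cup\dots\cup S_{t-1})$ is nonempty, takes a maximum weight independent set $S_t$ of $G[V_t]$ with respect to $w'$. Ties are broken arbitrarily, except that if $w'$ vanishes on all of $V_t$ then $S_t$ is an independent set of $G[V_t]$ of maximum cardinality. The vertices of $S_t$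 receive the color $\kappa_t$, where $\kappa_0,\kappa_1,\dots,\kappa_{2^m-1}$ is a list of all vectors of $\{0,1\}^m$ in an order of non-decreasing number of ones. The algorithm returns $\mathcal I_{\mathrm{greedy}}=(I_1,\dots,I_m)$, where $I_i$ is the set of the vertices whose color has a one in position $i$. Then, for every such choice of the sets $S_t$ and of the order of the colors, the algorithm colors all vertices using at most $2^m$ colors, $\mathcal I_{\mathrm{greedy}}$ is a graph separating system, and $$\mathrm{cost}(\mathcal I_{\mathrm{greedy}})\ \le\ (2+\varepsilon)\,\mathrm{OPT},\qquad \varepsilon=e^{-cm}+\frac1n .$$ -/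

import Mathlib

namespace InterventionDesign

/-- A graph is chordal if every cycle of length at least four has a chord: an edge of the graph
joining two vertices of the cycle that is not an edge of the cycle. -/
def IsChordal {V : Type*} (G : SimpleGraph V) : Prop :=
  ∀ (v : V) (p : G.Walk v v), p.IsCycle → 4 ≤ p.length →
    ∃ x ∈ p.support, ∃ y ∈ p.support, G.Adj x y ∧ s(x, y) ∉ p.edges

/-- The cut `δ(I)`: the edges with one endpoint in `I` and the other one outside `I`. -/
def cut {V : Type*} (G : SimpleGraph V) (I : Finset V) : Set (Sym2 V) :=
  {e | ∃ u v, e = s(u, v) ∧ G.Adj u v ∧ u ∈ I ∧ v ∉ I}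

/-- `I 0, …, I (k - 1)` is a graph separating system of size `k`: every edge is cut. -/
def IsSeparatingSystem {V : Type*} (G : SimpleGraph V) {k : ℕ} (I : Fin k → Finset V) : Prop :=
  ⋃ i, cut G (I i) = G.edgeSet

/-- The cost of an intervention design. -/
def cost {V : Type*} (w : V → ℕ) {k : ℕ} (I : Fin k → Finset V) : ℕ :=
  ∑ i, ∑ v ∈ I i, w v

/-- The optimal value of the minimum cost intervention design problem: the least cost of a
graph separating system of size at most `m`. -/
noncomputable def opt {V : Type*} (G : SimpleGraph V) (w : V → ℕ) (m : ℕ) : ℕ :=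
  sInf {x | ∃ k ≤ m, ∃ I : Fin k → Finset V, IsSeparatingSystem G I ∧ x = cost w I}

/-- `S` is a maximum weight independent set of the subgraph of `G` induced by `R`. -/
def IsMaxWeightIndepSet {V : Type*} (G : SimpleGraph V) (R : Finset V) (w : V → ℕ)
    (S : Finset V) : Prop :=
  (S ⊆ R ∧ G.IsIndepSet (S : Set V)) ∧
    ∀ T : Finset V, T ⊆ R → G.IsIndepSet (T : Set V) → ∑ v ∈ T, w v ≤ ∑ v ∈ S, w v

/-- The quantized weights `⌊w v * n ^ 3 / wmax⌋`, where `n` is the number of vertices and `wmax`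
is the maximum weight of a vertex outside `S₀` (the division is the floor division of `ℕ`).
They are only used for vertices outside `S₀`. -/
def quantize {V : Type*} [Fintype V] [DecidableEq V] (w : V → ℕ) (S₀ : Finset V) (v : V) : ℕ :=
  w v * Fintype.card V ^ 3 / (Finset.univ \ S₀).sup w

/-- The vertices of `G_t`: those that are in none of `S 0, …, S (t - 1)`. -/
def remaining {V : Type*} [Fintype V] [DecidableEq V] (S : ℕ → Finset V) (t : ℕ) : Finset V :=
  Finset.univ \ (Finset.range t).biUnion S

/-- `S` is the sequence of colour classes of a run of the greedy colouring algorithm with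
quantization. The class `S 0` is a maximum weight independent set of `G` for the weights `w`;
for `t ≥ 1`, `S t` is a maximum weight independent set of the graph `G_t` of the uncoloured
vertices for the quantized weights. Ties are broken arbitrarily, except that once every
uncoloured vertex has quantized weight zero, an independent set with the largest number of
vertices is chosen. The loop is left at the first `t` with `remaining S t = ∅`; from then on the
classes are empty. -/
def IsGreedyRun {V : Type*} [Fintype V] [DecidableEq V] (G : SimpleGraph V) (w : V → ℕ)
    (S : ℕ → Finset V) : Prop :=
  IsMaxWeightIndepSet G Finset.univ w (S 0) ∧
    ∀ t, 1 ≤ t →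
      IsMaxWeightIndepSet G (remaining S t) (quantize w (S 0)) (S t) ∧
        ((∀ v ∈ remaining S t, quantize w (S 0) v = 0) →
          IsMaxWeightIndepSet G (remaining S t) (fun _ => 1) (S t))

/-- The weight `‖c‖₁` of a colour `c ∈ {0, 1}^m`. -/
def colorWeight {m : ℕ} (c : Fin m → Bool) : ℕ :=
  (Finset.univ.filter fun i => c i = true).card

/-- `κ` lists all colours in `{0, 1}^m` in an order of non-decreasing weight (so `κ 0` is the
zero vector, and `κ t` is a cheapest colour not among `κ 0, …, κ (t - 1)`). -/
def IsColorOrder {m : ℕ} (κ : Fin (2 ^ m) ≃ (Fin m → Bool)) : Prop :=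
  ∀ s t, s ≤ t → colorWeight (κ s) ≤ colorWeight (κ t)

/-- The intervention design obtained by giving the vertices of `S t` the colour `κ t`:
the `i`-th intervention consists of the vertices whose colour has a one in position `i`. -/
def design {V : Type*} [Fintype V] [DecidableEq V] {m : ℕ} (S : ℕ → Finset V)
    (κ : Fin (2 ^ m) ≃ (Fin m → Bool)) (i : Fin m) : Finset V :=
  (Finset.univ.filter fun t : Fin (2 ^ m) => κ t i = true).biUnion fun t => S t

end InterventionDesign

/-! A separating system is a proper coloring by 0/1 vectors, and its cost is the sum over `j ≥ 1` of
the weight of vertices whose color has at least `j` ones (`cost_eq_sum_layerCost`). For the greedy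
design, this `j`-th term is the weight left after `layerCount m j` classes
(`IsGreedyRun.cost_design`). Fix an optimal system. Its colors with fewer than `⌈j/2⌉` ones give `K`
independent sets, so each greedy step removes at least a `1/K` fraction of the excess over what they
leave uncovered. Greedy has made at least `mK/4` quantized steps by then (`mul_layerCount_half_le`).
Hence, for `3 ≤ j ≤ m/2`, its `j`-th term is at most the optimal `⌈j/2⌉`-th term plus a decay error
`exp(-m/4)` and a rounding error `1/n²`, both relative to the weight outside `S 0`
(`IsGreedyRun.sum_remaining_le`). That weight is at most the optimal first term, which also settles
`j ≤ 2`. Each optimal term is used at most twice, whence the factor 2. Terms with `j > m/2` vanish: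
the run ends within `2^(m-1)` classes (`IsGreedyRun.remaining_eq_empty`), and the layers below such
`j` contain at least half of all colors. -/

namespace InterventionDesign

/-! ### Binomial estimates and layer counts -/

/-- The number of vectors of `{0, 1}^m` with fewer than `j` ones. -/
def layerCount (m j : ℕ) : ℕ := ∑ i ∈ Finset.range j, m.choose i

/-- The quotient of the two binomials is a product of factors `(a - i) / (b - i)`, each at most `a /
b`. -/
theorem choose_mul_pow_le {a b : ℕ} (h : a ≤ b) (k : ℕ) :
    a.choose k * b ^ k ≤ b.choose k * a ^ k := by
  induction k with
  | zero => simp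
  | succ k ih =>
    have hstep : (a - k) * b ≤ (b - k) * a := by
      rcases le_total a k with hk | hk
      · simp [Nat.sub_eq_zero_of_le hk]
      · obtain ⟨x, rfl⟩ := Nat.exists_eq_add_of_le hk
        obtain ⟨y, rfl⟩ := Nat.exists_eq_add_of_le h
        rw [show k + x - k = x by omega, show k + x + y - k = x + y by omega]
        nlinarith [Nat.zero_le (k * y)]
    refine Nat.le_of_mul_le_mul_right ?_ k.succ_pos
    calc a.choose (k + 1) * b ^ (k + 1) * (k + 1)
        = (a.choose (k + 1) * (k + 1)) * (b ^ k * b) := by ring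
      _ = (a.choose k * b ^ k) * ((a - k) * b) := by rw [Nat.choose_succ_right_eq]; ring
      _ ≤ (b.choose k * a ^ k) * ((b - k) * a) := Nat.mul_le_mul ih hstep
      _ = (b.choose (k + 1) * (k + 1)) * (a ^ k * a) := by rw [Nat.choose_succ_right_eq]; ring
      _ = b.choose (k + 1) * a ^ (k + 1) * (k + 1) := by ring

theorem mul_two_mul_add_one_le_pow {y : ℝ} (hy : 3 / 2 ≤ y) {i : ℕ} (hi : 1 ≤ i) :
    i * (2 * y + 1) / 4 ≤ y ^ i := by
  -- The induction step needs `i * y ≥ i + 1`, which follows from `y ≥ 3/2` only once `i ≥ 2`.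
  rcases Nat.lt_or_ge i 2 with h2 | h2
  · obtain rfl : i = 1 := by omega
    norm_num; linarith
  · induction i, h2 using Nat.le_induction with
    | base => norm_num; nlinarith
    | succ i h2 ih =>
      have h2' : (2 : ℝ) ≤ i := by exact_mod_cast h2
      have := ih (by omega)
      rw [pow_succ]
      push_cast
      have h3 : (i * (2 * y + 1) / 4) * y ≤ y ^ i * y :=
        mul_le_mul_of_nonneg_right this (by linarith)
      nlinarith [mul_nonneg (by linarith : (0:ℝ) ≤ 2 * y + 1) (by nlinarith : (0:ℝ) ≤ i * y - i - 1)]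

/-- The ratio `m.choose (2i) / m.choose i` equals `(m - i).choose i / (2i).choose i`, which is at
least `y ^ i` for `y = (m - i) / (2i)`. Since `i * (2y + 1) = m`, the preceding lemma gives `y ^ i ≥
m / 4`. -/
theorem mul_choose_le_choose_two_mul {m i : ℕ} (hi : 1 ≤ i) (hm : 4 * i ≤ m) :
    m * m.choose i ≤ 4 * m.choose (2 * i) := by
  have hid : m.choose (2 * i) * (2 * i).choose i = m.choose i * (m - i).choose i := by
    have := Nat.choose_mul (n := m) (k := 2 * i) (s := i) (by omega)
    rwa [show 2 * i - i = i by omega] at this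
  have hpow := choose_mul_pow_le (show 2 * i ≤ m - i by omega) i
  have hi' : (1 : ℝ) ≤ i := by exact_mod_cast hi
  have hm' : (4 * i : ℝ) ≤ m := by exact_mod_cast hm
  have hcast : ((m - i : ℕ) : ℝ) = m - i := by rw [Nat.cast_sub (by omega)]
  set y : ℝ := (m - i) / (2 * i) with hy
  have hyi : y * (2 * i) = m - i := by rw [hy]; field_simp
  have hy32 : 3 / 2 ≤ y := by rw [hy, le_div_iff₀ (by positivity)]; linarith
  have hmain := mul_two_mul_add_one_le_pow hy32 hi
  have hmy : (i : ℝ) * (2 * y + 1) = m := by linarith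
  rw [hmy] at hmain
  have hpow' : ((2 * i).choose i : ℝ) * y ^ i ≤ (m - i).choose i := by
    have h : ((2 * i).choose i : ℝ) * ((m - i : ℕ) : ℝ) ^ i
        ≤ (m - i).choose i * (2 * i : ℝ) ^ i := by exact_mod_cast hpow
    rw [hcast, ← hyi, mul_pow, ← mul_assoc] at h
    exact le_of_mul_le_mul_right h (by positivity)
  have hc : (0 : ℝ) < (2 * i).choose i := by exact_mod_cast Nat.choose_pos (by omega)
  have hid' : (m.choose (2 * i) : ℝ) * (2 * i).choose i = m.choose i * (m - i).choose i := by
    exact_mod_cast hid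
  have : (m : ℝ) * m.choose i ≤ 4 * m.choose (2 * i) := by
    refine le_of_mul_le_mul_right ?_ hc
    calc (m : ℝ) * m.choose i * (2 * i).choose i
        = 4 * m.choose i * ((2 * i).choose i * (m / 4)) := by ring
      _ ≤ 4 * m.choose i * ((2 * i).choose i * y ^ i) := by gcongr
      _ ≤ 4 * m.choose i * (m - i).choose i := by gcongr
      _ = 4 * m.choose (2 * i) * (2 * i).choose i := by linarith
  exact_mod_cast this

/-- Layer `i` is charged to layer `2i`, and layer `0` to layer `1`. The subtracted `1` is the zero
color, reserved for `S 0`, which is not chosen by quantized weight. -/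
theorem mul_layerCount_half_le {m j : ℕ} (hj : 3 ≤ j) (hjm : j ≤ m / 2) :
    m * layerCount m ((j + 1) / 2) ≤ 4 * (layerCount m j - 1) := by
  have h1 : layerCount m j - 1 = ∑ i ∈ Finset.Ico 1 j, m.choose i := by
    rw [layerCount, Finset.range_eq_Ico, Finset.sum_eq_sum_Ico_succ_bot (by omega)]
    simp
  let f : ℕ → ℕ := fun i => if i = 0 then 1 else 2 * i
  have hf : Set.InjOn f (Finset.range ((j + 1) / 2) : Set ℕ) := by
    intro a _ b _ h
    simp only [f] at h
    split_ifs at h <;> omega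
  have h2 : ∑ i ∈ Finset.range ((j + 1) / 2), m.choose (f i) ≤ ∑ i ∈ Finset.Ico 1 j, m.choose i := by
    rw [← Finset.sum_image hf]
    refine Finset.sum_le_sum_of_subset ?_
    intro x hx
    simp only [Finset.mem_image, Finset.mem_range, f] at hx
    obtain ⟨a, ha, rfl⟩ := hx
    rw [Finset.mem_Ico]
    split_ifs <;> omega
  rw [h1]
  refine le_trans ?_ (Nat.mul_le_mul_left 4 h2)
  rw [layerCount, Finset.mul_sum, Finset.mul_sum]
  refine Finset.sum_le_sum fun i hi => ?_
  rw [Finset.mem_range] at hi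
  by_cases h0 : i = 0
  · simp [h0, f]; omega
  · simp only [f, if_neg h0]
    exact mul_choose_le_choose_two_mul (by omega) (by omega)

theorem layerCount_mono (m : ℕ) : Monotone (layerCount m) := fun _ _ h =>
  Finset.sum_le_sum_of_subset (Finset.range_mono h)

theorem layerCount_mono_left {k m : ℕ} (h : k ≤ m) (j : ℕ) : layerCount k j ≤ layerCount m j :=
  Finset.sum_le_sum fun _ _ => Nat.choose_le_choose _ h

theorem layerCount_one (m : ℕ) : layerCount m 1 = 1 := by simp [layerCount]

theorem one_le_layerCount (m : ℕ) {j : ℕ} (hj : 1 ≤ j) : 1 ≤ layerCount m j :=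
  (layerCount_one m).symm.le.trans (layerCount_mono m hj)

theorem le_layerCount {m j : ℕ} (hj : j ≤ m + 1) : j ≤ layerCount m j := by
  calc j = ∑ i ∈ Finset.range j, 1 := by simp
    _ ≤ layerCount m j := Finset.sum_le_sum fun i hi =>
      Nat.choose_pos (by rw [Finset.mem_range] at hi; omega)

theorem two_pow_le_two_mul_layerCount {m j : ℕ} (hj : m / 2 < j) :
    2 ^ m ≤ 2 * layerCount m j := by
  have h1 : ∑ i ∈ Finset.range (m + 1), m.choose i
      ≤ ∑ i ∈ Finset.range (m / 2 + 1), m.choose i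
        + ∑ i ∈ Finset.range (m / 2 + 1), m.choose (m - i) := by
    -- The lower half of the layers and its reflection `i ↦ m - i` cover all layers.
    have hinj : Set.InjOn (fun i => m - i) (Finset.range (m / 2 + 1) : Set ℕ) := by
      intro a ha b hb h
      simp only [Finset.coe_range, Set.mem_Iio] at ha hb h
      omega
    rw [← Finset.sum_image (f := fun i => m.choose i) hinj, ← Finset.sum_union_inter]
    refine le_trans (Finset.sum_le_sum_of_subset ?_) (Nat.le_add_right _ _)
    intro x hx
    simp only [Finset.mem_union, Finset.mem_range, Finset.mem_image] at hx ⊢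
    by_cases h : x < m / 2 + 1
    · exact Or.inl h
    · exact Or.inr ⟨m - x, by omega, by omega⟩
  have h2 : ∑ i ∈ Finset.range (m / 2 + 1), m.choose (m - i) = layerCount m (m / 2 + 1) :=
    Finset.sum_congr rfl fun i hi => Nat.choose_symm (by rw [Finset.mem_range] at hi; omega)
  rw [Nat.sum_range_choose, h2] at h1
  have := layerCount_mono m (show m / 2 + 1 ≤ j by omega)
  have h3 : ∑ i ∈ Finset.range (m / 2 + 1), m.choose i = layerCount m (m / 2 + 1) := rfl
  omega

/-! ### Colors by weight -/

theorem card_colorWeight_eq (m i : ℕ) :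
    (Finset.univ.filter fun c : Fin m → Bool => colorWeight c = i).card = m.choose i := by
  have : m.choose i = (Finset.powersetCard i (Finset.univ : Finset (Fin m))).card := by simp
  rw [this]
  refine Finset.card_bij' (fun c _ => Finset.univ.filter fun x => c x = true)
    (fun s _ x => decide (x ∈ s)) ?_ ?_ ?_ ?_
  · intro c hc
    rw [Finset.mem_filter] at hc
    exact Finset.mem_powersetCard.mpr ⟨Finset.subset_univ _, hc.2⟩
  · intro s hs
    rw [Finset.mem_filter]
    exact ⟨Finset.mem_univ _, by simpa [colorWeight] using hs⟩
  · intro c _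
    ext x; simp
  · intro s _
    ext x; simp

theorem card_colorWeight_lt (m j : ℕ) :
    (Finset.univ.filter fun c : Fin m → Bool => colorWeight c < j).card = layerCount m j := by
  rw [layerCount, Finset.card_eq_sum_card_fiberwise (f := colorWeight) (t := Finset.range j)]
  · refine Finset.sum_congr rfl fun i hi => ?_
    rw [← card_colorWeight_eq, Finset.filter_filter]
    congr 1
    ext c
    simp only [Finset.mem_filter, Finset.mem_univ, true_and, and_iff_right_iff_imp]
    rintro rfl
    simpa using hi
  · intro c hc
    simpa using hc

/-- In a monotone order, the colors of weight below `j` form an initial segment, so its length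
determines it. -/
theorem IsColorOrder.colorWeight_lt_iff {m : ℕ} {κ : Fin (2 ^ m) ≃ (Fin m → Bool)}
    (hκ : IsColorOrder κ) (t : Fin (2 ^ m)) (j : ℕ) :
    colorWeight (κ t) < j ↔ (t : ℕ) < layerCount m j := by
  have hcard : (Finset.univ.filter fun s => colorWeight (κ s) < j).card = layerCount m j := by
    rw [← card_colorWeight_lt]
    exact Finset.card_equiv κ (by simp)
  constructor
  · intro h
    have : (Finset.Iic t).card ≤ _ := Finset.card_le_card
      (t := Finset.univ.filter fun s => colorWeight (κ s) < j) (by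
        intro s hs
        simp only [Finset.mem_filter, Finset.mem_univ, true_and]
        exact (hκ s t (Finset.mem_Iic.mp hs)).trans_lt h)
    rw [hcard, Fin.card_Iic] at this
    omega
  · intro h
    by_contra hn
    have : _ ≤ (Finset.Iio t).card := Finset.card_le_card
      (s := Finset.univ.filter fun s => colorWeight (κ s) < j) (by
        intro s hs
        simp only [Finset.mem_filter, Finset.mem_univ, true_and] at hs
        rw [Finset.mem_Iio]
        by_contra hts
        exact hn ((hκ t s (not_lt.mp hts)).trans_lt hs))
    rw [hcard, Fin.card_Iio] at this
    omega

/-! ### Greedy independent sets -/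

/-- A maximum weight independent set carries at least a `1 / K` fraction of the weight that `K`
independent colour classes cover. -/
theorem IsMaxWeightIndepSet.sum_le {V : Type*} {G : SimpleGraph V} {R : Finset V} {u : V → ℕ} {S : Finset V}
    (h : IsMaxWeightIndepSet G R u S) {ι : Type*} [DecidableEq ι] (col : V → ι) (B : Finset ι)
    (hB : ∀ b ∈ B, G.IsIndepSet {v | col v = b}) :
    ∑ v ∈ R, u v ≤ B.card * ∑ v ∈ S, u v + ∑ v ∈ R with col v ∉ B, u v := by
  rw [← Finset.sum_filter_add_sum_filter_not R (fun v => col v ∈ B)]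
  refine Nat.add_le_add_right ?_ _
  rw [← Finset.sum_fiberwise_of_maps_to (g := col) (t := B)
    (fun v hv => (Finset.mem_filter.mp hv).2), ← smul_eq_mul]
  refine Finset.sum_le_card_nsmul _ _ _ fun b hb => h.2 _ ?_ ?_
  · exact (Finset.filter_subset _ _).trans (Finset.filter_subset _ _)
  · refine (hB b hb).mono fun v hv => ?_
    simp only [Finset.coe_filter, Set.mem_ofPred_eq] at hv
    exact hv.2

theorem IsMaxWeightIndepSet.exists_pos {V : Type*} {G : SimpleGraph V} {R : Finset V} {u : V → ℕ}
    {S : Finset V} (h : IsMaxWeightIndepSet G R u S) {v : V} (hv : v ∈ R) (hu : 0 < u v) :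
    S.Nonempty := by
  by_contra hS
  rw [Finset.not_nonempty_iff_eq_empty] at hS
  have := h.2 {v} (by simpa using hv) (by simp [SimpleGraph.isIndepSet_iff])
  simp [hS] at this
  omega

section Greedy

variable {V : Type*} [Fintype V] [DecidableEq V]

theorem mem_remaining {S : ℕ → Finset V} {t : ℕ} {v : V} :
    v ∈ remaining S t ↔ ∀ s < t, v ∉ S s := by
  simp [remaining]

theorem remaining_zero (S : ℕ → Finset V) : remaining S 0 = Finset.univ := by
  simp [remaining]

theorem remaining_succ (S : ℕ → Finset V) (t : ℕ) :
    remaining S (t + 1) = remaining S t \ S t := by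
  ext v
  simp only [mem_remaining, Finset.mem_sdiff, Nat.lt_succ_iff_lt_or_eq]
  constructor
  · exact fun h => ⟨fun s hs => h s (Or.inl hs), h t (Or.inr rfl)⟩
  · rintro ⟨h1, h2⟩ s (hs | rfl)
    exacts [h1 s hs, h2]

theorem remaining_anti (S : ℕ → Finset V) : Antitone (remaining S) := fun _ _ h _ hv =>
  mem_remaining.mpr fun s hs => mem_remaining.mp hv s (hs.trans_le h)

theorem sum_remaining_succ {S : ℕ → Finset V} {t : ℕ} (h : S t ⊆ remaining S t) (u : V → ℕ) :
    (∑ v ∈ remaining S (t + 1), u v) + ∑ v ∈ S t, u v = ∑ v ∈ remaining S t, u v := by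
  rw [remaining_succ, Finset.sum_sdiff h]

theorem one_sub_inv_pow_le_exp {K : ℝ} (hK : 1 ≤ K) (a : ℕ) :
    (1 - 1 / K) ^ a ≤ Real.exp (-(a / K)) := by
  have h0 : 0 ≤ 1 - 1 / K := by
    rw [sub_nonneg, div_le_one (by linarith)]; exact hK
  calc (1 - 1 / K) ^ a ≤ Real.exp (-(1 / K)) ^ a :=
        pow_le_pow_left₀ h0 (Real.one_sub_le_exp_neg _) a
    _ = Real.exp (-(a / K)) := by rw [← Real.exp_nat_mul]; congr 1; ring

/-- Geometric decay of the uncoloured weight towards the weight that `B.card` independent classes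
leave uncovered. -/
theorem sum_remaining_le_of_greedy {G : SimpleGraph V} {S : ℕ → Finset V} {u : V → ℕ} {t₀ : ℕ}
    (hS : ∀ t, t₀ ≤ t → IsMaxWeightIndepSet G (remaining S t) u (S t))
    {ι : Type*} [DecidableEq ι] (col : V → ι) (B : Finset ι)
    (hB : ∀ b ∈ B, G.IsIndepSet {v | col v = b}) (hne : B.Nonempty) (a : ℕ) :
    (∑ v ∈ remaining S (t₀ + a), u v : ℝ) ≤
      (∑ v ∈ remaining S t₀ with col v ∉ B, u v : ℝ)
        + Real.exp (-(a / B.card)) * ∑ v ∈ remaining S t₀, (u v : ℝ) := by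
  set r : ℝ := (∑ v ∈ remaining S t₀ with col v ∉ B, u v : ℝ) with hr
  have hr0 : 0 ≤ r := Finset.sum_nonneg fun _ _ => Nat.cast_nonneg _
  have hK : (1 : ℝ) ≤ B.card := by exact_mod_cast hne.card_pos
  have h0 : 0 ≤ 1 - 1 / (B.card : ℝ) := by
    rw [sub_nonneg, div_le_one (by linarith)]; exact hK
  -- Only the excess over the uncovered weight `r` contracts by `1 - 1/K` per step.
  have key : ∀ a : ℕ, (∑ v ∈ remaining S (t₀ + a), u v : ℝ) - r ≤
      (1 - 1 / (B.card : ℝ)) ^ a * ((∑ v ∈ remaining S t₀, (u v : ℝ)) - r) := by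
    intro a
    induction a with
    | zero => simp
    | succ a ih =>
      have hm := hS (t₀ + a) (by omega)
      have h1 : (∑ v ∈ remaining S (t₀ + a), u v : ℝ) ≤
          B.card * (∑ v ∈ S (t₀ + a), u v : ℝ) + r := by
        have h1 : ∑ v ∈ remaining S (t₀ + a), u v ≤ B.card * (∑ v ∈ S (t₀ + a), u v)
            + ∑ v ∈ remaining S t₀ with col v ∉ B, u v :=
          (hm.sum_le col B hB).trans (Nat.add_le_add_left (Finset.sum_le_sum_of_subset
            (Finset.filter_subset_filter _ (remaining_anti S (by omega)))) _)
        rw [hr]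
        exact_mod_cast h1
      have h2 : (∑ v ∈ remaining S (t₀ + (a + 1)), u v : ℝ) + ∑ v ∈ S (t₀ + a), (u v : ℝ)
          = ∑ v ∈ remaining S (t₀ + a), (u v : ℝ) := by
        exact_mod_cast sum_remaining_succ hm.1.1 u
      have h3 : ((∑ v ∈ remaining S (t₀ + a), u v : ℝ) - r) / B.card ≤
          ∑ v ∈ S (t₀ + a), (u v : ℝ) := by
        rw [div_le_iff₀ (by linarith)]; linarith
      calc (∑ v ∈ remaining S (t₀ + (a + 1)), u v : ℝ) - r
          ≤ (1 - 1 / (B.card : ℝ)) * ((∑ v ∈ remaining S (t₀ + a), u v : ℝ) - r) := by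
            rw [sub_mul, one_mul, one_div_mul_eq_div]; linarith
        _ ≤ (1 - 1 / (B.card : ℝ)) * ((1 - 1 / (B.card : ℝ)) ^ a *
              ((∑ v ∈ remaining S t₀, (u v : ℝ)) - r)) := mul_le_mul_of_nonneg_left ih h0
        _ = _ := by rw [pow_succ]; ring
  have hU : (0 : ℝ) ≤ ∑ v ∈ remaining S t₀, (u v : ℝ) :=
    Finset.sum_nonneg fun _ _ => Nat.cast_nonneg _
  have h4 := mul_le_mul_of_nonneg_left (sub_le_self (∑ v ∈ remaining S t₀, (u v : ℝ)) hr0)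
    (pow_nonneg h0 a)
  have h5 := mul_le_mul_of_nonneg_right (one_sub_inv_pow_le_exp hK a) hU
  linarith [key a]

theorem IsGreedyRun.isMaxWeight {G : SimpleGraph V} {w : V → ℕ} {S : ℕ → Finset V}
    (h : IsGreedyRun G w S) (t : ℕ) : ∃ u, IsMaxWeightIndepSet G (remaining S t) u (S t) := by
  rcases Nat.eq_zero_or_pos t with rfl | ht
  · exact ⟨w, by rw [remaining_zero]; exact h.1⟩
  · exact ⟨_, (h.2 t ht).1⟩

theorem IsGreedyRun.subset_remaining {G : SimpleGraph V} {w : V → ℕ} {S : ℕ → Finset V}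
    (h : IsGreedyRun G w S) (t : ℕ) : S t ⊆ remaining S t :=
  (h.isMaxWeight t).choose_spec.1.1

theorem IsGreedyRun.isIndepSet {G : SimpleGraph V} {w : V → ℕ} {S : ℕ → Finset V}
    (h : IsGreedyRun G w S) (t : ℕ) : G.IsIndepSet (S t : Set V) :=
  (h.isMaxWeight t).choose_spec.1.2

theorem IsGreedyRun.eq_of_mem {G : SimpleGraph V} {w : V → ℕ} {S : ℕ → Finset V}
    (h : IsGreedyRun G w S) {s t : ℕ} {v : V} (hs : v ∈ S s) (ht : v ∈ S t) : s = t := by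
  by_contra hne
  rcases Nat.lt_or_gt_of_ne hne with hlt | hlt
  · exact mem_remaining.mp (h.subset_remaining t ht) s hlt hs
  · exact mem_remaining.mp (h.subset_remaining s hs) t hlt ht

theorem IsGreedyRun.nonempty {G : SimpleGraph V} {w : V → ℕ} {S : ℕ → Finset V}
    (h : IsGreedyRun G w S) (hw : ∀ v, 0 < w v) {t : ℕ} (ht : (remaining S t).Nonempty) :
    (S t).Nonempty := by
  rcases Nat.eq_zero_or_pos t with rfl | h1
  · obtain ⟨v, -⟩ := ht
    exact h.1.exists_pos (Finset.mem_univ v) (hw v)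
  · by_cases h0 : ∀ v ∈ remaining S t, quantize w (S 0) v = 0
    · obtain ⟨v, hv⟩ := ht
      exact ((h.2 t h1).2 h0).exists_pos hv one_pos
    · push Not at h0
      obtain ⟨v, hv, hne⟩ := h0
      exact (h.2 t h1).1.exists_pos hv (Nat.pos_of_ne_zero hne)

/-- Every class chosen before exhaustion contains a vertex. This later limits the number of layers
that incur a rounding error. -/
theorem IsGreedyRun.lt_card {G : SimpleGraph V} {w : V → ℕ} {S : ℕ → Finset V}
    (h : IsGreedyRun G w S) (hw : ∀ v, 0 < w v) {t : ℕ} (ht : (remaining S t).Nonempty) :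
    t < Fintype.card V := by
  have key : ∀ s ≤ t, s + (remaining S s).card ≤ Fintype.card V := by
    intro s hs
    induction s with
    | zero => simp [remaining_zero]
    | succ s ih =>
      have h1 := ih (by omega)
      have h2 := sum_remaining_succ (h.subset_remaining s) fun _ => 1
      simp only [Finset.sum_const, smul_eq_mul, mul_one] at h2
      have h3 := (h.nonempty hw (ht.mono (remaining_anti S (by omega : s ≤ t)))).card_pos
      omega
  have := key t le_rfl
  have := ht.card_pos
  omega

end Greedy

/-! ### Separating systems as colorings, and cost by layers -/

/-- The colour of a vertex in the colouring associated with an intervention design. -/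
def colorOf {V : Type*} [DecidableEq V] {k : ℕ} (I : Fin k → Finset V) (v : V) : Fin k → Bool :=
  fun i => decide (v ∈ I i)

/-- The weight of the vertices whose colour has at least `j` ones. -/
def layerCost {V : Type*} [Fintype V] [DecidableEq V] (w : V → ℕ) {k : ℕ}
    (I : Fin k → Finset V) (j : ℕ) : ℕ :=
  ∑ v with j ≤ colorWeight (colorOf I v), w v

theorem IsSeparatingSystem.colorOf_ne {V : Type*} [DecidableEq V] {G : SimpleGraph V} {k : ℕ}
    {I : Fin k → Finset V} (h : IsSeparatingSystem G I) {u v : V} (huv : G.Adj u v) :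
    colorOf I u ≠ colorOf I v := by
  intro heq
  have he : s(u, v) ∈ ⋃ i, cut G (I i) := by rw [h]; exact huv
  obtain ⟨i, x, y, hxy, -, hx, hy⟩ := Set.mem_iUnion.mp he
  have hi : u ∈ I i ↔ v ∈ I i := by simpa [colorOf] using congrFun heq i
  rcases Sym2.eq_iff.mp hxy with ⟨rfl, rfl⟩ | ⟨rfl, rfl⟩
  · exact hy (hi.mp hx)
  · exact hy (hi.mpr hx)

theorem IsSeparatingSystem.isIndepSet_colorOf {V : Type*} [DecidableEq V] {G : SimpleGraph V}
    {k : ℕ} {I : Fin k → Finset V} (h : IsSeparatingSystem G I) (c : Fin k → Bool) :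
    G.IsIndepSet {v | colorOf I v = c} :=
  fun _ hu _ hv _ huv => h.colorOf_ne huv (Eq.trans hu (Eq.symm hv))

theorem colorWeight_le {k : ℕ} (c : Fin k → Bool) : colorWeight c ≤ k :=
  (Finset.card_filter_le _ _).trans (by simp)

theorem colorWeight_eq_zero {k : ℕ} {c : Fin k → Bool} (h : colorWeight c = 0) :
    c = fun _ => false := by
  funext i
  rw [colorWeight, Finset.card_eq_zero, Finset.filter_eq_empty_iff] at h
  simpa using h (Finset.mem_univ i)

section Cost

variable {V : Type*} [Fintype V] [DecidableEq V]

/-- A vertex pays its weight once per one in its color; the double sum is exchanged. Layers above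
`k` are empty, so `m` may replace `k`. -/
theorem cost_eq_sum_layerCost (w : V → ℕ) {k m : ℕ} (hk : k ≤ m) (I : Fin k → Finset V) :
    cost w I = ∑ j ∈ Finset.Icc 1 m, layerCost w I j := by
  have h1 : cost w I = ∑ v, colorWeight (colorOf I v) * w v := by
    simp only [cost, colorWeight, colorOf, decide_eq_true_eq,
      Finset.card_filter, Finset.sum_mul, ite_mul, one_mul, zero_mul]
    rw [Finset.sum_comm]
    refine Finset.sum_congr rfl fun i _ => ?_
    rw [← Finset.sum_filter]
    simp
  have h2 : ∀ c ≤ m, c = ((Finset.Icc 1 m).filter fun j => j ≤ c).card := by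
    intro c hc
    have : (Finset.Icc 1 m).filter (fun j => j ≤ c) = Finset.Icc 1 c := by
      ext j; simp only [Finset.mem_filter, Finset.mem_Icc]; omega
    simp [this]
  rw [h1]
  simp only [layerCost, Finset.sum_filter]
  rw [Finset.sum_comm]
  refine Finset.sum_congr rfl fun v _ => ?_
  conv_lhs => rw [h2 (colorWeight (colorOf I v)) ((colorWeight_le _).trans hk)]
  rw [Finset.card_filter, Finset.sum_mul]
  simp

/-! ### Termination and the effect of quantization -/

theorem quantize_le (w : V → ℕ) {S₀ : Finset V} {v : V} (hv : v ∈ Finset.univ \ S₀) :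
    quantize w S₀ v ≤ Fintype.card V ^ 3 :=
  Nat.div_le_of_le_mul (Nat.mul_le_mul_right _ (Finset.le_sup hv))

theorem remaining_one (S : ℕ → Finset V) : remaining S 1 = Finset.univ \ S 0 := by
  simp [remaining]

/-- The `χ` classes of a proper coloring leave nothing uncovered, so the weight decays to at most
`exp(-a/χ) * n^4 < 1`; being an integer, it is zero. -/
theorem sum_remaining_eq_zero {G : SimpleGraph V} {S : ℕ → Finset V} {u : V → ℕ} {t₀ : ℕ}
    (hS : ∀ t, t₀ ≤ t → IsMaxWeightIndepSet G (remaining S t) u (S t)) {χ : ℕ}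
    (C : G.Coloring (Fin χ)) (hn : 2 ≤ Fintype.card V) {a : ℕ}
    (ha : 4 * Real.logb 2 (Fintype.card V) * χ ≤ a)
    (hu : ∑ v ∈ remaining S t₀, u v ≤ Fintype.card V ^ 4) :
    ∑ v ∈ remaining S (t₀ + a), u v = 0 := by
  have hV : Nonempty V := Fintype.card_pos_iff.mp (by omega)
  have hχ : 0 < χ := (Nat.zero_le _).trans_lt (C hV.some).isLt
  have hχ' : (0 : ℝ) < χ := by exact_mod_cast hχ
  have hdec := sum_remaining_le_of_greedy hS C Finset.univ
    (fun b _ x hx y hy _ hxy => C.valid hxy (Eq.trans hx (Eq.symm hy)))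
    ⟨⟨0, hχ⟩, Finset.mem_univ _⟩ a
  simp only [Finset.mem_univ, not_true_eq_false, Finset.filter_false, Finset.sum_empty, zero_add,
    Finset.card_univ, Fintype.card_fin] at hdec
  have hn' : (1 : ℝ) < Fintype.card V := by exact_mod_cast hn
  have hlog : Real.log (Fintype.card V) < Real.logb 2 (Fintype.card V) := by
    have h2 : Real.log 2 < 1 := by linarith [Real.log_two_lt_d9]
    rw [Real.logb, lt_div_iff₀ (Real.log_pos one_lt_two)]
    nlinarith [Real.log_pos hn']
  have hexp : Real.exp (-(a / χ)) * (Fintype.card V : ℝ) ^ 4 < 1 := by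
    have h4 : (Fintype.card V : ℝ) ^ 4 = Real.exp (4 * Real.log (Fintype.card V)) := by
      rw [← Real.exp_log (show (0 : ℝ) < Fintype.card V by linarith), ← Real.exp_nat_mul]
      simp
    rw [h4, ← Real.exp_add, Real.exp_lt_one_iff]
    have : 4 * Real.logb 2 (Fintype.card V) ≤ a / χ := by rwa [le_div_iff₀ hχ']
    linarith
  have hu' : (∑ v ∈ remaining S t₀, (u v : ℝ)) ≤ (Fintype.card V : ℝ) ^ 4 := by exact_mod_cast hu
  have hlt : (∑ v ∈ remaining S (t₀ + a), u v : ℝ) < 1 :=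
    (hdec.trans (mul_le_mul_of_nonneg_left hu' (Real.exp_pos _).le)).trans_lt hexp
  have : ∑ v ∈ remaining S (t₀ + a), u v < 1 := by exact_mod_cast hlt
  omega

/-- One class is `S 0`, the next `a` exhaust the quantized weight, and the last `a`, chosen by
cardinality, exhaust the vertices. -/
theorem IsGreedyRun.remaining_eq_empty {G : SimpleGraph V} {w : V → ℕ} {S : ℕ → Finset V}
    (h : IsGreedyRun G w S) {χ : ℕ} (C : G.Coloring (Fin χ)) (hn : 2 ≤ Fintype.card V) {a : ℕ}
    (ha : 4 * Real.logb 2 (Fintype.card V) * χ ≤ a) : remaining S (1 + a + a) = ∅ := by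
  have h1 : ∑ v ∈ remaining S (1 + a), quantize w (S 0) v = 0 := by
    refine sum_remaining_eq_zero (fun t ht => (h.2 t ht).1) C hn ha ?_
    calc ∑ v ∈ remaining S 1, quantize w (S 0) v
        ≤ ∑ v ∈ remaining S 1, Fintype.card V ^ 3 :=
          Finset.sum_le_sum fun v hv => quantize_le w (by rwa [← remaining_one])
      _ ≤ Fintype.card V * Fintype.card V ^ 3 := by
          rw [Finset.sum_const, smul_eq_mul]
          exact Nat.mul_le_mul_right _ (Finset.card_le_univ _)
      _ = Fintype.card V ^ 4 := by ring
  rw [Finset.sum_eq_zero_iff] at h1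
  have h2 : ∑ v ∈ remaining S (1 + a + a), 1 = 0 := by
    refine sum_remaining_eq_zero (u := fun _ => 1) (fun t ht => (h.2 t (by omega)).2 fun v hv =>
      h1 v (remaining_anti S ht hv)) C hn ha ?_
    rw [Finset.sum_const, smul_eq_mul, mul_one]
    exact (Finset.card_le_univ _).trans (Nat.le_self_pow (by norm_num) _)
  simpa using h2

/-- The vertices of zero color under `I` are independent, hence no heavier than `S 0`. -/
theorem IsGreedyRun.sum_remaining_one_le {G : SimpleGraph V} {w : V → ℕ} {S : ℕ → Finset V}
    (h : IsGreedyRun G w S) {k : ℕ} {I : Fin k → Finset V} (hI : IsSeparatingSystem G I) :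
    ∑ v ∈ remaining S 1, w v ≤ layerCost w I 1 := by
  have h1 := h.1.2 (Finset.univ.filter fun v => ¬ 1 ≤ colorWeight (colorOf I v))
    (Finset.subset_univ _) ((hI.isIndepSet_colorOf fun _ => false).mono fun v hv => by
      simp only [Finset.coe_filter, Finset.mem_univ, true_and, Set.mem_ofPred_eq] at hv
      exact colorWeight_eq_zero (by omega))
  have h2 := Finset.sum_filter_add_sum_filter_not Finset.univ
    (fun v => 1 ≤ colorWeight (colorOf I v)) w
  have h3 := sum_remaining_succ (h.subset_remaining 0) w
  rw [remaining_zero, zero_add] at h3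
  rw [layerCost]
  omega

theorem IsGreedyRun.sum_remaining_le {G : SimpleGraph V} {w : V → ℕ} {S : ℕ → Finset V}
    (h : IsGreedyRun G w S) (hw : ∀ v, 0 < w v) {k m : ℕ} (hk : k ≤ m) {I : Fin k → Finset V}
    (hI : IsSeparatingSystem G I) {j : ℕ} (hj : 3 ≤ j) (hjm : j ≤ m / 2)
    (hne : (remaining S (layerCount m j)).Nonempty) :
    (∑ v ∈ remaining S (layerCount m j), w v : ℝ) ≤ layerCost w I ((j + 1) / 2)
      + Real.exp (-(m / 4)) * (∑ v ∈ remaining S 1, w v : ℝ)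
      + (∑ v ∈ remaining S 1, w v : ℝ) / (Fintype.card V : ℝ) ^ 2 := by
  set N := layerCount m j with hN
  set n := Fintype.card V with hn
  set q := quantize w (S 0) with hq
  set W := (Finset.univ \ S 0).sup w with hW
  have hN1 : 1 ≤ N := one_le_layerCount m (by omega)
  obtain ⟨v₀, hv₀⟩ := hne
  have hn0 : 0 < n := Fintype.card_pos_iff.mpr ⟨v₀⟩
  have hn0' : (0 : ℝ) < n := by exact_mod_cast hn0
  have hsub : remaining S N ⊆ remaining S 1 := remaining_anti S hN1
  have hleW : ∀ v ∈ remaining S 1, w v ≤ W := fun v hv =>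
    Finset.le_sup (f := w) (by rwa [← remaining_one])
  have hWpos : 0 < W := (hw v₀).trans_le (hleW v₀ (hsub hv₀))
  have hWpos' : (0 : ℝ) < W := by exact_mod_cast hWpos
  have hWU : (W : ℝ) ≤ ∑ v ∈ remaining S 1, (w v : ℝ) := by
    have : W ≤ ∑ v ∈ remaining S 1, w v := by
      rw [remaining_one]
      exact Finset.sup_le fun v hv => Finset.single_le_sum (fun _ _ => Nat.zero_le _) hv
    exact_mod_cast this
  -- One quantization unit: rounding loses at most `s` per vertex, so at most `s * n = W / n^2` in
  -- total.
  set s : ℝ := W / (n : ℝ) ^ 3 with hs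
  have hs0 : 0 < s := by positivity
  have hq1 : ∀ v, s * q v ≤ w v := by
    intro v
    have h1 : q v * W ≤ w v * n ^ 3 := Nat.div_mul_le_self _ _
    rw [hs, div_mul_eq_mul_div, div_le_iff₀ (by positivity)]
    calc (W : ℝ) * q v = ((q v * W : ℕ) : ℝ) := by push_cast; ring
      _ ≤ ((w v * n ^ 3 : ℕ) : ℝ) := by exact_mod_cast h1
      _ = w v * (n : ℝ) ^ 3 := by push_cast; ring
  have hq2 : ∀ v, (w v : ℝ) ≤ s * q v + s := by
    intro v
    have h1 : w v * n ^ 3 ≤ (q v + 1) * W := by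
      rw [mul_comm (q v + 1)]
      exact (Nat.lt_mul_div_succ _ hWpos).le
    rw [hs, ← mul_add_one, div_mul_eq_mul_div, le_div_iff₀ (by positivity)]
    calc (w v : ℝ) * (n : ℝ) ^ 3 = ((w v * n ^ 3 : ℕ) : ℝ) := by push_cast; ring
      _ ≤ (((q v + 1) * W : ℕ) : ℝ) := by exact_mod_cast h1
      _ = W * ((q v : ℝ) + 1) := by push_cast; ring
  -- Vertices with colors outside `B` are exactly those counted by `layerCost w I ((j + 1) / 2)`.
  let B := Finset.univ.filter fun c : Fin k → Bool => colorWeight c < (j + 1) / 2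
  have hBcard : B.card = layerCount k ((j + 1) / 2) := card_colorWeight_lt k _
  have hBpos : 0 < B.card := by rw [hBcard]; exact one_le_layerCount k (by omega)
  have hdec := sum_remaining_le_of_greedy (fun t ht => (h.2 t ht).1) (colorOf I) B
    (fun b _ => hI.isIndepSet_colorOf b) (Finset.card_pos.mp hBpos) (N - 1)
  rw [Nat.add_sub_of_le hN1] at hdec
  have hexp : Real.exp (-(((N - 1 : ℕ) : ℝ) / B.card)) ≤ Real.exp (-(m / 4)) := by
    have h1 : m * B.card ≤ 4 * (N - 1) := by
      rw [hBcard]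
      exact (Nat.mul_le_mul_left m (layerCount_mono_left hk _)).trans
        (mul_layerCount_half_le hj hjm)
    have h2 : (m : ℝ) * B.card ≤ 4 * (N - 1 : ℕ) := by exact_mod_cast h1
    have h3 : (0 : ℝ) < B.card := by exact_mod_cast hBpos
    rw [Real.exp_le_exp, neg_le_neg_iff, le_div_iff₀ h3]
    linarith
  have hrest : s * (∑ v ∈ remaining S 1 with colorOf I v ∉ B, (q v : ℝ))
      ≤ layerCost w I ((j + 1) / 2) := by
    rw [Finset.mul_sum, layerCost, Nat.cast_sum]
    refine (Finset.sum_le_sum fun v _ => hq1 v).trans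
      (Finset.sum_le_sum_of_subset_of_nonneg ?_ fun _ _ _ => Nat.cast_nonneg _)
    intro v hv
    simpa [B] using (Finset.mem_filter.mp hv).2
  have htot : s * (∑ v ∈ remaining S 1, (q v : ℝ)) ≤ ∑ v ∈ remaining S 1, (w v : ℝ) := by
    rw [Finset.mul_sum]
    exact Finset.sum_le_sum fun v _ => hq1 v
  have hcard : s * ((remaining S N).card : ℝ)
      ≤ (∑ v ∈ remaining S 1, w v : ℝ) / (n : ℝ) ^ 2 := by
    have h1 : ((remaining S N).card : ℝ) ≤ n := by exact_mod_cast Finset.card_le_univ _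
    calc s * ((remaining S N).card : ℝ) ≤ s * n := by gcongr
      _ = W / (n : ℝ) ^ 2 := by rw [hs]; field_simp
      _ ≤ _ := by gcongr
  have hlow : (∑ v ∈ remaining S N, (w v : ℝ))
      ≤ s * (∑ v ∈ remaining S N, (q v : ℝ)) + s * ((remaining S N).card : ℝ) := by
    refine (Finset.sum_le_sum fun v _ => hq2 v).trans (le_of_eq ?_)
    rw [Finset.sum_add_distrib, Finset.mul_sum, Finset.sum_const, nsmul_eq_mul, mul_comm s]
  have hq0 : (0 : ℝ) ≤ ∑ v ∈ remaining S 1, (q v : ℝ) :=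
    Finset.sum_nonneg fun _ _ => Nat.cast_nonneg _
  have h1 := mul_le_mul_of_nonneg_left
    (hdec.trans (add_le_add_right (mul_le_mul_of_nonneg_right hexp hq0) _)) hs0.le
  have h2 := mul_le_mul_of_nonneg_left htot (Real.exp_pos (-(m / 4 : ℝ))).le
  rw [mul_add] at h1
  linarith

/-! ### The greedy design and its cost -/

theorem IsGreedyRun.colorOf_design {G : SimpleGraph V} {w : V → ℕ} {S : ℕ → Finset V}
    (h : IsGreedyRun G w S) {m : ℕ} (κ : Fin (2 ^ m) ≃ (Fin m → Bool)) {t : Fin (2 ^ m)} {v : V}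
    (hv : v ∈ S t) : colorOf (design S κ) v = κ t := by
  funext i
  rw [Bool.eq_iff_iff]
  simp only [colorOf, design, decide_eq_true_eq, Finset.mem_biUnion, Finset.mem_filter,
    Finset.mem_univ, true_and]
  constructor
  · rintro ⟨s, hs, hvs⟩
    rwa [← Fin.ext (h.eq_of_mem hvs hv)]
  · exact fun ht => ⟨t, ht, hv⟩

theorem exists_mem_of_remaining_eq_empty {S : ℕ → Finset V} {T : ℕ} (hT : remaining S T = ∅)
    (v : V) : ∃ t : Fin T, v ∈ S t := by
  have : v ∉ remaining S T := by simp [hT]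
  rw [mem_remaining] at this
  push Not at this
  obtain ⟨t, ht, hv⟩ := this
  exact ⟨⟨t, ht⟩, hv⟩

theorem IsGreedyRun.isSeparatingSystem_design {G : SimpleGraph V} {w : V → ℕ}
    {S : ℕ → Finset V} (h : IsGreedyRun G w S) {m : ℕ} (κ : Fin (2 ^ m) ≃ (Fin m → Bool))
    (hm : remaining S (2 ^ m) = ∅) : IsSeparatingSystem G (design S κ) := by
  refine Set.Subset.antisymm ?_ ?_
  · refine Set.iUnion_subset fun i => ?_
    rintro _ ⟨u, v, rfl, huv, -, -⟩
    exact huv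
  · intro e he
    induction e with | _ u v
    have huv : G.Adj u v := he
    obtain ⟨s, hs⟩ := exists_mem_of_remaining_eq_empty hm u
    obtain ⟨t, ht⟩ := exists_mem_of_remaining_eq_empty hm v
    have hne : colorOf (design S κ) u ≠ colorOf (design S κ) v := by
      rw [h.colorOf_design κ hs, h.colorOf_design κ ht]
      intro heq
      obtain rfl := κ.injective heq
      exact h.isIndepSet s hs ht huv.ne huv
    obtain ⟨i, hi⟩ := Function.ne_iff.mp hne
    rw [Set.mem_iUnion]
    refine ⟨i, ?_⟩
    by_cases hu : u ∈ design S κ i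
    · exact ⟨u, v, rfl, huv, hu, fun hv => hi (by simp [colorOf, hu, hv])⟩
    · refine ⟨v, u, Sym2.eq_swap, huv.symm, ?_, hu⟩
      by_contra hv
      exact hi (by simp [colorOf, hu, hv])

theorem IsGreedyRun.cost_design {G : SimpleGraph V} {w : V → ℕ} {S : ℕ → Finset V}
    (h : IsGreedyRun G w S) {m : ℕ} {κ : Fin (2 ^ m) ≃ (Fin m → Bool)} (hκ : IsColorOrder κ)
    (hm : remaining S (2 ^ m) = ∅) :
    cost w (design S κ) =
      ∑ j ∈ Finset.Icc 1 m, ∑ v ∈ remaining S (layerCount m j), w v := by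
  rw [cost_eq_sum_layerCost w le_rfl]
  refine Finset.sum_congr rfl fun j _ => ?_
  rw [layerCost]
  refine Finset.sum_congr ?_ fun _ _ => rfl
  ext v
  obtain ⟨t, ht⟩ := exists_mem_of_remaining_eq_empty hm v
  simp only [Finset.mem_filter, Finset.mem_univ, true_and]
  rw [h.colorOf_design κ ht, ← not_lt, hκ.colorWeight_lt_iff, not_lt, mem_remaining]
  constructor
  · intro hle s hs hvs
    have := h.eq_of_mem hvs ht
    omega
  · intro hall
    by_contra hlt
    exact hall t (not_le.mp hlt) ht

end Cost

/-! ### Summing the layer bounds -/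

/-- The value `i` is `⌈j/2⌉` for exactly `j = 2i - 1` and `j = 2i`; this is the source of the factor
2. -/
theorem sum_half_le (g : ℕ → ℝ) (hg : ∀ i, 0 ≤ g i) (m : ℕ) :
    ∑ j ∈ Finset.Icc 1 m, (if j ≤ m / 2 then g ((j + 1) / 2) else 0)
      ≤ 2 * ∑ i ∈ Finset.Icc 1 m, g i := by
  have h1 : ∀ M : ℕ, ∑ j ∈ Finset.Icc 1 (2 * M), g ((j + 1) / 2)
      = 2 * ∑ i ∈ Finset.Icc 1 M, g i := by
    intro M
    induction M with
    | zero => simp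
    | succ M ih =>
      rw [show 2 * (M + 1) = 2 * M + 1 + 1 by ring, Finset.sum_Icc_succ_top (by omega),
        Finset.sum_Icc_succ_top (by omega), Finset.sum_Icc_succ_top (by omega), ih,
        show (2 * M + 1 + 1) / 2 = M + 1 by omega, show (2 * M + 1 + 1 + 1) / 2 = M + 1 by omega]
      ring
  rw [← h1, ← Finset.sum_filter]
  refine Finset.sum_le_sum_of_subset_of_nonneg ?_ fun _ _ _ => hg _
  intro j hj
  simp only [Finset.mem_filter, Finset.mem_Icc] at hj ⊢
  omega

/-- There are at most `m/2 - 2 ≤ exp(m/5)` terms, and `1/4 - 1/5 = 1/20`. -/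
theorem sum_exp_le {m : ℕ} (hm : 4 ≤ m) :
    ∑ j ∈ Finset.Icc 1 m, (if 3 ≤ j ∧ j ≤ m / 2 then Real.exp (-(m / 4)) else 0)
      ≤ Real.exp (-(1 / 20 * m)) := by
  have h1 : (Finset.Icc 1 m).filter (fun j => 3 ≤ j ∧ j ≤ m / 2) = Finset.Icc 3 (m / 2) := by
    ext j
    simp only [Finset.mem_filter, Finset.mem_Icc]
    omega
  rw [← Finset.sum_filter, h1, Finset.sum_const, Nat.card_Icc, nsmul_eq_mul]
  have h2 : ((m / 2 + 1 - 3 : ℕ) : ℝ) ≤ m / 2 - 2 := by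
    rw [show m / 2 + 1 - 3 = m / 2 - 2 by omega, Nat.cast_sub (by omega)]
    have := Nat.cast_div_le (α := ℝ) (m := m) (n := 2)
    push_cast at this ⊢
    linarith
  have h3 : (m : ℝ) / 2 - 2 ≤ Real.exp (m / 5) := by
    have h4 := Real.add_one_le_exp ((m : ℝ) / 5 - 1)
    have h5 : Real.exp ((m : ℝ) / 5) = Real.exp 1 * Real.exp ((m : ℝ) / 5 - 1) := by
      rw [← Real.exp_add]; congr 1; ring
    have h6 : (5 / 2 : ℝ) ≤ Real.exp 1 := by linarith [Real.exp_one_gt_d9]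
    rw [h5]
    nlinarith [Real.exp_pos ((m : ℝ) / 5 - 1)]
  calc ((m / 2 + 1 - 3 : ℕ) : ℝ) * Real.exp (-(m / 4))
      ≤ Real.exp (m / 5) * Real.exp (-(m / 4)) := by gcongr; exact h2.trans h3
    _ = Real.exp (-(1 / 20 * m)) := by rw [← Real.exp_add]; congr 1; ring

theorem sum_card_le {n : ℕ} (hn : 0 < n) (m : ℕ) :
    ∑ j ∈ Finset.Icc 1 m, (if j < n then 1 / (n : ℝ) ^ 2 else 0) ≤ 1 / (n : ℝ) := by
  rw [← Finset.sum_filter, Finset.sum_const, nsmul_eq_mul]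
  have h1 : ((Finset.Icc 1 m).filter fun j => j < n).card ≤ n := by
    refine (Finset.card_le_card (t := Finset.range n) ?_).trans (by simp)
    intro j hj
    simpa using (Finset.mem_filter.mp hj).2
  have hn' : (0 : ℝ) < n := by exact_mod_cast hn
  calc (((Finset.Icc 1 m).filter fun j => j < n).card : ℝ) * (1 / (n : ℝ) ^ 2)
      ≤ n * (1 / (n : ℝ) ^ 2) := by gcongr
    _ = 1 / (n : ℝ) := by field_simp

theorem le_two_pow_of_logb_add_le {χ n : ℝ} (hχ : 0 < χ) (hn : 1 < n) {m : ℕ}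
    (h : Real.logb 2 χ + Real.logb 2 (Real.logb 2 n) + 5 ≤ m) :
    32 * (χ * Real.logb 2 n) ≤ 2 ^ m := by
  have hl : 0 < Real.logb 2 n := Real.logb_pos one_lt_two hn
  rw [← Real.logb_mul hχ.ne' hl.ne'] at h
  have h1 := Real.rpow_le_rpow_of_exponent_le (x := 2) (by norm_num) h
  rw [Real.rpow_add two_pos, Real.rpow_logb two_pos (by norm_num) (by positivity),
    Real.rpow_natCast] at h1
  norm_num at h1
  linarith

theorem IsGreedyRun.cost_design_le {V : Type*} [Fintype V] [DecidableEq V] {G : SimpleGraph V}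
    {w : V → ℕ} {S : ℕ → Finset V} (h : IsGreedyRun G w S) (hw : ∀ v, 0 < w v) {m : ℕ}
    (hm : 4 ≤ m) (hn : 0 < Fintype.card V) {κ : Fin (2 ^ m) ≃ (Fin m → Bool)}
    (hκ : IsColorOrder κ) (hS : remaining S (2 ^ (m - 1)) = ∅) {k : ℕ} (hk : k ≤ m)
    {I : Fin k → Finset V} (hI : IsSeparatingSystem G I) :
    (cost w (design S κ) : ℝ) ≤
      (2 + (Real.exp (-(1 / 20 * m)) + 1 / (Fintype.card V : ℝ))) * (cost w I : ℝ) := by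
  have hpow : 2 ^ m = 2 * 2 ^ (m - 1) := by rw [← pow_succ']; congr 1; omega
  have hempty : ∀ t, 2 ^ (m - 1) ≤ t → remaining S t = ∅ := fun t ht =>
    Finset.subset_empty.mp (hS ▸ remaining_anti S ht)
  set C : ℝ := (cost w I : ℝ) with hC
  have hCsum : C = ∑ j ∈ Finset.Icc 1 m, (layerCost w I j : ℝ) := by
    rw [hC, cost_eq_sum_layerCost w hk, Nat.cast_sum]
  have hU : (∑ v ∈ remaining S 1, w v : ℝ) ≤ layerCost w I 1 := by
    exact_mod_cast h.sum_remaining_one_le hI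
  have hUC : (∑ v ∈ remaining S 1, w v : ℝ) ≤ C := by
    rw [hCsum]
    exact hU.trans (Finset.single_le_sum (f := fun j => (layerCost w I j : ℝ))
      (fun _ _ => Nat.cast_nonneg _) (Finset.mem_Icc.mpr ⟨le_rfl, by omega⟩))
  have hC0 : 0 ≤ C := Nat.cast_nonneg _
  have hterm : ∀ j ∈ Finset.Icc 1 m, (∑ v ∈ remaining S (layerCount m j), w v : ℝ) ≤
      (if j ≤ m / 2 then (layerCost w I ((j + 1) / 2) : ℝ) else 0)
        + (if 3 ≤ j ∧ j ≤ m / 2 then Real.exp (-(m / 4)) else 0) * C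
        + (if j < Fintype.card V then 1 / (Fintype.card V : ℝ) ^ 2 else 0) * C := by
    intro j hj
    rw [Finset.mem_Icc] at hj
    have h0a : (0 : ℝ) ≤ if j ≤ m / 2 then (layerCost w I ((j + 1) / 2) : ℝ) else 0 := by
      split_ifs <;> positivity
    have h0b : 0 ≤ (if 3 ≤ j ∧ j ≤ m / 2 then Real.exp (-(m / 4)) else 0) * C := by
      split_ifs <;> positivity
    have h0c : 0 ≤ (if j < Fintype.card V then 1 / (Fintype.card V : ℝ) ^ 2 else 0) * C := by
      split_ifs <;> positivity
    rcases (remaining S (layerCount m j)).eq_empty_or_nonempty with he | hne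
    · rw [he, Finset.sum_empty]
      linarith
    -- Otherwise `layerCount m j ≥ 2^(m-1)`, and nothing remains.
    have hjm : j ≤ m / 2 := by
      by_contra hlt
      have := two_pow_le_two_mul_layerCount (m := m) (j := j) (by omega)
      rw [hempty _ (by omega)] at hne
      exact Finset.not_nonempty_empty hne
    rcases Nat.lt_or_ge j 3 with h3 | h3
    · have h1 : (∑ v ∈ remaining S (layerCount m j), w v : ℝ)
          ≤ ∑ v ∈ remaining S 1, (w v : ℝ) :=
        Finset.sum_le_sum_of_subset_of_nonneg
          (remaining_anti S (one_le_layerCount m hj.1)) fun _ _ _ => Nat.cast_nonneg _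
      rw [if_pos hjm, show (j + 1) / 2 = 1 by omega] at h0a ⊢
      linarith
    -- Each of the first `j` layers contains a color, so at least `j` classes precede the nonempty
    -- remainder.
    · have hjn : j < Fintype.card V :=
        (le_layerCount (by omega)).trans_lt (h.lt_card hw hne)
      rw [if_pos hjm, if_pos ⟨h3, hjm⟩, if_pos hjn, one_div_mul_eq_div]
      refine (h.sum_remaining_le hw hk hI h3 hjm hne).trans ?_
      gcongr
  have hcost : (cost w (design S κ) : ℝ) =
      ∑ j ∈ Finset.Icc 1 m, ∑ v ∈ remaining S (layerCount m j), (w v : ℝ) := by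
    have := h.cost_design hκ (hempty _ (by omega))
    exact_mod_cast this
  rw [hcost]
  refine (Finset.sum_le_sum hterm).trans ?_
  rw [Finset.sum_add_distrib, Finset.sum_add_distrib, ← Finset.sum_mul, ← Finset.sum_mul]
  have e1 := sum_half_le (fun i => (layerCost w I i : ℝ)) (fun _ => Nat.cast_nonneg _) m
  have e2 := mul_le_mul_of_nonneg_right (sum_exp_le hm) hC0
  have e3 := mul_le_mul_of_nonneg_right (sum_card_le hn m) hC0
  rw [← hCsum] at e1
  linarith

end InterventionDesign

theorem mainTheorem1 :
    ∃ c : ℝ, 0 < c ∧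
      ∀ (V : Type*) [Fintype V] [DecidableEq V] (G : SimpleGraph V) (w : V → ℕ) (m : ℕ),
        InterventionDesign.IsChordal G →
        (∀ v, 0 < w v) →
        2 ≤ Fintype.card V →
        Real.logb 2 (G.chromaticNumber.toNat : ℝ)
          + Real.logb 2 (Real.logb 2 (Fintype.card V : ℝ)) + 5 ≤ (m : ℝ) →
        ∀ (S : ℕ → Finset V) (κ : Fin (2 ^ m) ≃ (Fin m → Bool)),
          InterventionDesign.IsGreedyRun G w S →
          InterventionDesign.IsColorOrder κ →
          InterventionDesign.remaining S (2 ^ m) = ∅ ∧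
          InterventionDesign.IsSeparatingSystem G (InterventionDesign.design S κ) ∧
          (InterventionDesign.cost w (InterventionDesign.design S κ) : ℝ) ≤
            (2 + (Real.exp (-(c * m)) + 1 / (Fintype.card V : ℝ)))
              * (InterventionDesign.opt G w m : ℝ) := by
  refine ⟨1 / 20, by norm_num, ?_⟩
  intro V _ _ G w m _ hw hn hm S κ hS hκ
  obtain ⟨C⟩ := G.colorable_chromaticNumber G.colorable_of_fintype
  set χ := G.chromaticNumber.toNat with hχdef
  have hV : Nonempty V := Fintype.card_pos_iff.mp (by omega)
  have hχ : 0 < χ := (Nat.zero_le _).trans_lt (C hV.some).isLt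
  have hχ' : (1 : ℝ) ≤ χ := by exact_mod_cast hχ
  have hn' : (2 : ℝ) ≤ Fintype.card V := by exact_mod_cast hn
  have hbound := InterventionDesign.le_two_pow_of_logb_add_le (by linarith) (by linarith) hm
  have hlog : 1 ≤ Real.logb 2 (Fintype.card V : ℝ) := by
    rw [Real.le_logb_iff_rpow_le one_lt_two (by linarith)]
    simpa using hn'
  have hm5 : 5 ≤ m := by
    have h1 : ((2 ^ 5 : ℕ) : ℝ) ≤ ((2 ^ m : ℕ) : ℝ) := by
      push_cast
      nlinarith
    exact (Nat.pow_le_pow_iff_right one_lt_two).mp (by exact_mod_cast h1)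
  -- With `m = l + 3`, the bound `32 χ log n ≤ 2^m` becomes `4 χ log n ≤ 2^l`, so `a = 2^l` is
  -- admissible and `1 + 2a ≤ 2^(m-1)`.
  obtain ⟨l, rfl⟩ := Nat.exists_eq_add_of_le' (show 3 ≤ m by omega)
  have hhalf : InterventionDesign.remaining S (2 ^ (l + 3 - 1)) = ∅ := by
    have ha : 4 * Real.logb 2 (Fintype.card V) * χ ≤ ((2 ^ l : ℕ) : ℝ) := by
      rw [pow_add] at hbound
      push_cast
      linarith
    have hle : 1 + 2 ^ l + 2 ^ l ≤ 2 ^ (l + 3 - 1) := by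
      rw [show l + 3 - 1 = l + 2 by omega, pow_add]
      have := Nat.one_le_two_pow (n := l)
      omega
    exact Finset.subset_empty.mp
      (hS.remaining_eq_empty C hn ha ▸ InterventionDesign.remaining_anti S hle)
  have hfull : InterventionDesign.remaining S (2 ^ (l + 3)) = ∅ :=
    Finset.subset_empty.mp (hhalf ▸ InterventionDesign.remaining_anti S
      (Nat.pow_le_pow_right two_pos (by omega)))
  have hsep := hS.isSeparatingSystem_design κ hfull
  refine ⟨hfull, hsep, ?_⟩
  -- The greedy design itself shows that the set is nonempty, so `opt` is attained rather than the
  -- default `0` of `sInf ∅`.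
  obtain ⟨k, hk, I, hI, hopt⟩ := Nat.sInf_mem
    (s := {x | ∃ k ≤ l + 3, ∃ I : Fin k → Finset V,
      InterventionDesign.IsSeparatingSystem G I ∧ x = InterventionDesign.cost w I})
    ⟨_, l + 3, le_rfl, _, hsep, rfl⟩
  have hopt' : InterventionDesign.opt G w (l + 3) = InterventionDesign.cost w I := hopt
  rw [hopt']
  exact hS.cost_design_le hw (by omega) (by omega) hκ hhalf hk hI
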